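/- A digraph has neither loops nor pairs of opposite arcs. For a graph $G$ and a digraph $\vec H$ write $G\to\vec H$ if for every orientation $\vec G$ of $G$ there is an injective map $f:V_{\vec H}\to V_G$ such that, for all $u,v\in V_{\vec H}$, $(u,v)$ is an arc of $\vec H$ if and only if $(f(u),f(v))$ is an arc of $\vec G$. Let $\mathcal T_n$ be the class of all oriented trees on $n$ vertices (digraphs on $n$ vertices whose underlying undirected graph is a tree), and let $R(\mathcal T_n)\in\{0,1,2,\dots\}\cup\{\infty\}$ be the smallest number of vertices of a graph $G$ such that $G\to\vec T$ for every $\vec T\in\mathcal T_n$ (with $R(\mathcal T_n)=\infty$ if no finite such $G$ exists). **Theorem.** The minimum $$K:=\min_{x>1}\frac{16x^2}{1-x+x\ln x}$$ exists, and $K\approx 98.8249$ (more precisely, $|K-98.8249|<5\cdot10^{-5}$). For every real $\varepsilon>0$ there exists $n_\varepsilon\in\mathbb N$ such that $$R(\mathcal T_n)<(K+\varepsilon)\,n^4\ln n\qquad\text{for all } n\ge n_\varepsilon .$$ Consequently, $R(\mathcal T_n)<99\,n^4\ln n$ for all sufficiently large $n$. -/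

import Mathlib

/-- An oriented graph: a digraph having neither loops nor pairs of opposite arcs. -/
def Digraph.IsOriented {V : Type*} (D : Digraph V) : Prop :=
  ∀ u v, D.Adj u v → ¬ D.Adj v u

/-- `D` is an orientation of the simple graph `G`: it is obtained from `G` by choosing exactly one
of the two directions for every edge of `G`. -/
def Digraph.IsOrientationOf {V : Type*} (D : Digraph V) (G : SimpleGraph V) : Prop :=
  D.IsOriented ∧ D.toSimpleGraphInclusive = G

/-- `D` contains an induced copy of `H`: there is an injection `f` of the vertices of `H` into those
of `D` such that `(u, v)` is an arc of `H` if and only if `(f u, f v)` is an arc of `D`. -/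
def Digraph.ContainsInducedCopy {V W : Type*} (D : Digraph V) (H : Digraph W) : Prop :=
  ∃ f : W → V, Function.Injective f ∧ ∀ u v, H.Adj u v ↔ D.Adj (f u) (f v)

/-- The arrow relation `G → H`: every orientation of `G` contains an induced copy of `H`. -/
def SimpleGraph.Arrows {V W : Type*} (G : SimpleGraph V) (H : Digraph W) : Prop :=
  ∀ D : Digraph V, D.IsOrientationOf G → D.ContainsInducedCopy H

/-- The (non-isometric) oriented Ramsey number of a class of digraphs: the smallest number of
vertices of a graph `G` with `G → H` for all `H` in the class (and `⊤` if there is no such finite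
graph). -/
noncomputable def orientedRamsey (𝓗 : Set (Σ W : Type, Digraph W)) : ℕ∞ :=
  sInf {m : ℕ∞ | ∃ (V : Type) (G : SimpleGraph V),
    ENat.card V = m ∧ ∀ H ∈ 𝓗, G.Arrows H.2}

/-- The class of all oriented trees on `n` vertices. -/
def orientedTrees (n : ℕ) : Set (Σ W : Type, Digraph W) :=
  {H | ENat.card H.1 = n ∧ H.2.IsOriented ∧ H.2.toSimpleGraphInclusive.IsTree}

/-! A bound without the logarithm holds: $R(\mathcal T_n)\le 324n^4$. The host is the polarity graph
on $\mathbb F_q^2$, with $q$ a prime between $9n^2$ and $18n^2$. Two vertices have at most one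
common neighbour, and a second-moment estimate makes every large vertex set dense
(`polarityGraph_locallyDense`). In any orientation, all but few vertices of a large set therefore
have many out-neighbours (likewise in-neighbours) inside it. Embedding the tree minus a leaf among
such vertices leaves room to attach the leaf, and small codegrees keep the copy induced
(`Digraph.exists_induced_tree`). Since $K>98$, the stated bound follows once $\ln n\ge4$. The value
of $K$ is separate calculus: the minimiser solves $x\ln x=2(x-1)$. -/

/-! ### Embedding oriented trees in locally dense graphs -/

open Finset in
/-- Double counting: if `r` relates any two adjacent vertices in one of the two directions, and every
vertex of `A` has at most `k` `r`-successors in `A`, then the degree sum of `G[A]` is at most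
`2 * k * #A`. -/
lemma SimpleGraph.sum_card_filter_adj_le {V : Type*} {G : SimpleGraph V} {r : V → V → Prop}
    [DecidableRel G.Adj] [DecidableRel r] (hr : ∀ u v, G.Adj u v → r u v ∨ r v u)
    {A : Finset V} {k : ℕ} (hk : ∀ v ∈ A, #{w ∈ A | r v w} ≤ k) :
    ∑ v ∈ A, #{w ∈ A | G.Adj v w} ≤ 2 * k * #A := by
  classical
  have h1 : ∑ v ∈ A, #{w ∈ A | r v w} ≤ k * #A := by
    simpa [mul_comm] using sum_le_card_nsmul A _ k hk
  have h2 : ∑ v ∈ A, #{w ∈ A | r w v} = ∑ v ∈ A, #{w ∈ A | r v w} :=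
    (sum_card_bipartiteAbove_eq_sum_card_bipartiteBelow (s := A) (t := A) r).symm
  calc ∑ v ∈ A, #{w ∈ A | G.Adj v w}
      ≤ ∑ v ∈ A, (#{w ∈ A | r v w} + #{w ∈ A | r w v}) := by
        refine sum_le_sum fun v _ ↦ (card_le_card fun w hw ↦ ?_).trans (card_union_le _ _)
        have := hr v w
        simp only [mem_filter, mem_union] at hw ⊢
        tauto
    _ ≤ 2 * k * #A := by rw [sum_add_distrib, h2]; linarith

/-- Every set of at least `a` vertices spans a subgraph of average degree larger than `2 * k`. -/
def SimpleGraph.LocallyDense {V : Type*} (G : SimpleGraph V) [DecidableRel G.Adj] (a k : ℕ) : Prop :=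
  ∀ A : Finset V, a ≤ A.card → 2 * k * A.card < ∑ v ∈ A, (A.filter (G.Adj v)).card

open Finset in
-- The vertices with at most `k` successors span too few edges for local density, so there are fewer
-- than `a` of them.
lemma SimpleGraph.LocallyDense.card_lt {V : Type*} {G : SimpleGraph V} {r : V → V → Prop}
    [DecidableRel G.Adj] [DecidableRel r] {a k : ℕ} (hG : G.LocallyDense a k)
    (hr : ∀ u v, G.Adj u v → r u v ∨ r v u) (S : Finset V) :
    #S < #{v ∈ S | k < #{w ∈ S | r v w}} + a := by
  classical
  by_contra! h
  have hc := card_filter_add_card_filter_not (s := S) (fun v ↦ k < #{w ∈ S | r v w})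
  refine (hG {v ∈ S | ¬ k < #{w ∈ S | r v w}} (by omega)).not_ge
    (sum_card_filter_adj_le hr fun v hv ↦ ?_)
  rw [mem_filter, not_lt] at hv
  exact (card_le_card (filter_subset_filter _ (filter_subset _ _))).trans hv.2

lemma Digraph.IsOriented.irrefl {V : Type*} {D : Digraph V} (hD : D.IsOriented) (v : V) :
    ¬ D.Adj v v := fun h ↦ hD v v h h

lemma Digraph.IsOriented.toSimpleGraphInclusive_adj {V : Type*} {D : Digraph V} (hD : D.IsOriented)
    {u v : V} : D.toSimpleGraphInclusive.Adj u v ↔ D.Adj u v ∨ D.Adj v u := by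
  simp only [Digraph.toSimpleGraphInclusive, SimpleGraph.fromRel_adj, and_iff_right_iff_imp]
  rintro h rfl
  exact h.elim (hD.irrefl u) (hD.irrefl u)

/-- A tree with at least two vertices has a leaf, whose removal leaves a tree. -/
lemma SimpleGraph.IsTree.exists_leaf {W : Type*} [Finite W] [Nontrivial W] {T : SimpleGraph W}
    (hT : T.IsTree) :
    ∃ l p, T.Adj l p ∧ (∀ x, T.Adj l x → x = p) ∧ (T.induce {l}ᶜ).IsTree := by
  classical
  have := Fintype.ofFinite W
  obtain ⟨l, hl⟩ := hT.exists_vert_degree_one_of_nontrivial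
  obtain ⟨p, hp, hu⟩ := SimpleGraph.degree_eq_one_iff_existsUnique_adj.mp hl
  exact ⟨l, p, hp, hu, hT.connected.induce_compl_singleton_of_degree_eq_one hl,
    hT.isAcyclic.induce _⟩

open Finset in
/-- A vertex `v ∈ X` with many `r`-successors in `S` has one outside of `X` which is adjacent to no
other vertex of `X`, provided codegrees are at most one. -/
lemma SimpleGraph.exists_private_successor {V : Type*} [Fintype V] {G : SimpleGraph V}
    [DecidableRel G.Adj] [DecidableEq V] {r : V → V → Prop} [DecidableRel r]
    (hr : ∀ u v, r u v → G.Adj u v)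
    (hcod : ∀ u v, u ≠ v → #{w | G.Adj u w ∧ G.Adj v w} ≤ 1) {S X : Finset V} {v : V}
    (hS : 2 * #X < #{w ∈ S | r v w}) :
    ∃ w ∈ S, r v w ∧ w ∉ X ∧ ∀ u ∈ X, u ≠ v → ¬ G.Adj u w := by
  by_contra! h
  refine hS.not_ge ?_
  calc #{w ∈ S | r v w}
      ≤ #(X ∪ (X.erase v).biUnion fun u ↦ {w | G.Adj u w ∧ G.Adj v w}) := by
        refine card_le_card fun w hw ↦ ?_
        simp only [mem_filter, mem_union, mem_biUnion, mem_erase, mem_univ, true_and] at hw ⊢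
        by_cases hX : w ∈ X
        · exact .inl hX
        · obtain ⟨u, hu, huv, huw⟩ := h w hw.1 hw.2 hX
          exact .inr ⟨u, ⟨huv, hu⟩, huw, hr _ _ hw.2⟩
    _ ≤ #X + ∑ u ∈ X.erase v, 1 := (card_union_le _ _).trans <| by
        gcongr
        exact card_biUnion_le.trans (sum_le_sum fun u hu ↦ hcod u v (ne_of_mem_erase hu))
    _ ≤ 2 * #X := by
        have := card_erase_le (s := X) (a := v)
        simp only [sum_const, smul_eq_mul, mul_one]
        omega

open Finset in
/-- In an orientation of a locally dense graph with codegrees at most one, every large set contains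
an induced copy of every oriented tree. -/
lemma Digraph.exists_induced_tree {V : Type*} [Fintype V] {G : SimpleGraph V} [DecidableRel G.Adj]
    {a k : ℕ} (hG : G.LocallyDense a k)
    (hcod : ∀ u v, u ≠ v → #{w | G.Adj u w ∧ G.Adj v w} ≤ 1)
    {D : Digraph V} (hD : D.IsOrientationOf G) (m : ℕ) :
    ∀ {W : Type} {H : Digraph W}, Nat.card W = m + 1 → 2 * (m + 1) ≤ k → H.IsOriented →
      H.toSimpleGraphInclusive.IsTree → ∀ S : Finset V, m * a < #S →
      ∃ f : W → V, Function.Injective f ∧ (∀ x, f x ∈ S) ∧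
        ∀ u v, H.Adj u v ↔ D.Adj (f u) (f v) := by
  classical
  obtain ⟨hDo, rfl⟩ := hD
  induction m with
  | zero =>
    intro W H hW _ hH _ S hS
    obtain ⟨s, hs⟩ := card_pos.mp (by omega : 0 < #S)
    have := (Nat.card_eq_one_iff_unique.mp (by omega : Nat.card W = 1)).1
    refine ⟨fun _ ↦ s, fun x y _ ↦ Subsingleton.elim x y, fun _ ↦ hs, fun u v ↦ ?_⟩
    rw [Subsingleton.elim v u]
    exact iff_of_false (hH.irrefl u) (hDo.irrefl s)
  | succ m ih =>
    intro W H hW hk hH hT S hS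
    have : Finite W := Nat.finite_of_card_ne_zero (by omega)
    have := Fintype.ofFinite W
    have : Nontrivial W := (Finite.one_lt_card_iff_nontrivial).mp (by omega)
    obtain ⟨l, p, hlp, huniq, hT'⟩ := hT.exists_leaf
    have hpl : p ≠ l := hlp.ne'
    rw [hH.toSimpleGraphInclusive_adj] at hlp
    -- `r` is the direction in which the leaf has to be attached.
    obtain ⟨r, hrG, hGr, hrl⟩ : ∃ r : V → V → Prop,
        (∀ u v, r u v → D.toSimpleGraphInclusive.Adj u v) ∧
        (∀ u v, D.toSimpleGraphInclusive.Adj u v → r u v ∨ r v u) ∧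
        ∀ u v, r u v → (H.Adj p l ↔ D.Adj u v) ∧ (H.Adj l p ↔ D.Adj v u) := by
      simp only [hDo.toSimpleGraphInclusive_adj]
      by_cases h : H.Adj p l
      · exact ⟨D.Adj, by tauto, by tauto, fun u v huv ↦
          ⟨iff_of_true h huv, iff_of_false (hH _ _ h) (hDo _ _ huv)⟩⟩
      · exact ⟨fun u v ↦ D.Adj v u, by tauto, by tauto, fun u v huv ↦
          ⟨iff_of_false h (hDo _ _ huv), iff_of_true (hlp.resolve_right h) huv⟩⟩
    let H' : Digraph ↥({l}ᶜ : Set W) := ⟨fun x y ↦ H.Adj x y⟩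
    have hH' : H'.IsOriented := fun x y ↦ hH x y
    have hT'' : H'.toSimpleGraphInclusive.IsTree := by
      convert hT' using 1
      ext x y
      rw [hH'.toSimpleGraphInclusive_adj, SimpleGraph.comap_adj]
      exact hH.toSimpleGraphInclusive_adj.symm
    have hW' : Nat.card ↥({l}ᶜ : Set W) = m + 1 := by
      have := Set.ncard_add_ncard_compl ({l} : Set W)
      rw [Set.ncard_singleton, hW] at this
      rw [Nat.card_coe_set_eq]
      omega
    -- Fewer than `a` vertices are lost per leaf, which is why `m * a < #S` suffices. The parent may
    -- land on any remaining vertex and still have enough successors in `S`.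
    have hB := hG.card_lt hGr S
    obtain ⟨f, hf, hfS, hfa⟩ := ih hW' (by omega) hH' hT''
      {v ∈ S | k < #{w ∈ S | r v w}} (by rw [add_mul] at hS; omega)
    simp only [mem_filter] at hfS
    have hX : #(univ.image f) = m + 1 := by
      rw [card_image_of_injective _ hf, card_univ, ← Nat.card_eq_fintype_card, hW']
    obtain ⟨w, hwS, hrw, hwX, hw⟩ := SimpleGraph.exists_private_successor hrG hcod (S := S)
      (X := univ.image f) (v := f ⟨p, hpl⟩) (by have := (hfS ⟨p, hpl⟩).2; omega)
    simp only [mem_image, mem_univ, true_and, not_exists, forall_exists_index,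
      forall_apply_eq_imp_iff] at hwX hw
    have hnew : ∀ x : W, ∀ hx : x ≠ l,
        (H.Adj x l ↔ D.Adj (f ⟨x, hx⟩) w) ∧ (H.Adj l x ↔ D.Adj w (f ⟨x, hx⟩)) := by
      intro x hx
      by_cases hxp : x = p
      · subst hxp
        exact hrl _ _ hrw
      · have h1 := mt (huniq x) hxp
        have h2 := hw ⟨x, hx⟩ fun h ↦ hxp (congrArg Subtype.val (hf h))
        rw [hH.toSimpleGraphInclusive_adj] at h1
        rw [hDo.toSimpleGraphInclusive_adj] at h2
        tauto
    refine ⟨fun x ↦ if hx : x = l then w else f ⟨x, hx⟩, fun x y hxy ↦ ?_, fun x ↦ ?_,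
      fun x y ↦ ?_⟩
    · by_cases hx : x = l <;> by_cases hy : y = l <;> simp only [hx, hy, dite_true, dite_false] at hxy
      · rw [hx, hy]
      · exact absurd hxy.symm (hwX _)
      · exact absurd hxy (hwX _)
      · exact congrArg Subtype.val (hf hxy)
    · by_cases hx : x = l <;> simp only [hx, dite_true, dite_false]
      · exact hwS
      · exact (hfS _).1
    · by_cases hx : x = l <;> by_cases hy : y = l <;> simp only [hx, hy, dite_true, dite_false]
      · exact iff_of_false (hH.irrefl l) (hDo.irrefl w)
      · exact (hnew y hy).2
      · exact (hnew x hx).1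
      · exact hfa ⟨x, hx⟩ ⟨y, hy⟩

/-! ### Polarity graphs and the bound of order $n^4$ -/

/-- The graph on `F × F` in which `(a, b)` and `(c, d)` are adjacent whenever `b + d = a * c`: the
polarity graph of an affine part of the projective plane over `F`. -/
def polarityGraph (F : Type*) [CommRing F] : SimpleGraph (F × F) where
  Adj u v := u ≠ v ∧ u.2 + v.2 = u.1 * v.1
  symm := ⟨fun u v h ↦ ⟨h.1.symm, by rw [add_comm, h.2, mul_comm]⟩⟩
  loopless := ⟨fun u h ↦ h.1 rfl⟩

section Polarity

open Finset

variable {F : Type*} [Field F] [Fintype F] [DecidableEq F]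

lemma card_filter_polarity (u : F × F) : #{v : F × F | v.2 + u.2 = v.1 * u.1} = Fintype.card F := by
  rw [← card_univ, ← card_image_of_injective univ
    (f := fun c : F ↦ ((c, c * u.1 - u.2) : F × F)) fun c d h ↦ congrArg Prod.fst h]
  congr 1
  ext ⟨c, d⟩
  simp only [mem_filter, mem_univ, true_and, mem_image, Prod.mk.injEq]
  constructor
  · intro h
    exact ⟨c, rfl, by rw [← h]; ring⟩
  · rintro ⟨_, rfl, rfl⟩
    ring

/-- The conditions describe two distinct non-vertical lines, with slopes `u.1` and `v.1`. -/
lemma card_filter_polarity_and_le_one {u v : F × F} (huv : u ≠ v) :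
    #{w : F × F | w.2 + u.2 = w.1 * u.1 ∧ w.2 + v.2 = w.1 * v.1} ≤ 1 := by
  rw [card_le_one]
  rintro ⟨a, b⟩ h ⟨c, d⟩ h'
  simp only [mem_filter, mem_univ, true_and] at h h'
  have hne : u.1 - v.1 ≠ 0 := by
    intro h0
    refine huv (Prod.ext (sub_eq_zero.mp h0) ?_)
    linear_combination h.1 - h.2 + a * h0
  have hac : a = c := mul_right_cancel₀ hne (by linear_combination h.2 - h.1 - h'.2 + h'.1)
  subst hac
  rw [Prod.mk.injEq]
  exact ⟨rfl, by linear_combination h.1 - h'.1⟩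

lemma sum_card_filter_polarity (A : Finset (F × F)) :
    ∑ v : F × F, #{w ∈ A | v.2 + w.2 = v.1 * w.1} = Fintype.card F * #A := by
  have := sum_card_bipartiteAbove_eq_sum_card_bipartiteBelow (s := univ) (t := A)
    fun v w : F × F ↦ v.2 + w.2 = v.1 * w.1
  simp only [bipartiteAbove, bipartiteBelow] at this
  rw [this, sum_congr rfl fun w _ ↦ card_filter_polarity w]
  simp [mul_comm]

lemma sum_card_filter_polarity_sq_le (A : Finset (F × F)) :
    ∑ v : F × F, #{w ∈ A | v.2 + w.2 = v.1 * w.1} ^ 2 ≤ Fintype.card F * #A + #A ^ 2 := by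
  have h := sum_card_bipartiteAbove_eq_sum_card_bipartiteBelow (s := univ) (t := A ×ˢ A)
    fun (v : F × F) (w : (F × F) × F × F) ↦
      v.2 + w.1.2 = v.1 * w.1.1 ∧ v.2 + w.2.2 = v.1 * w.2.1
  simp only [bipartiteAbove, bipartiteBelow] at h
  have h1 : ∀ v : F × F, #{w ∈ A ×ˢ A | v.2 + w.1.2 = v.1 * w.1.1 ∧ v.2 + w.2.2 = v.1 * w.2.1} =
      #{w ∈ A | v.2 + w.2 = v.1 * w.1} ^ 2 := fun v ↦ by
    rw [sq, ← card_product]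
    congr 1
    ext
    simp only [mem_filter, mem_product]
    tauto
  rw [sum_congr rfl fun v _ ↦ (h1 v).symm, h, sum_product]
  calc _ ≤ ∑ x ∈ A, ∑ y ∈ A, ((if x = y then Fintype.card F else 0) + 1) := by
        gcongr with x _ y _
        split_ifs with hxy
        · subst hxy
          simp [card_filter_polarity]
        · simpa using card_filter_polarity_and_le_one hxy
    _ = _ := by
        simp [sum_add_distrib]
        ring

lemma polarityGraph_codegree_le_one [DecidableRel (polarityGraph F).Adj] (u v : F × F)
    (huv : u ≠ v) : #{w | (polarityGraph F).Adj u w ∧ (polarityGraph F).Adj v w} ≤ 1 := by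
  refine le_trans (card_le_card fun w hw ↦ ?_) (card_filter_polarity_and_le_one huv)
  simp only [mem_filter, mem_univ, true_and] at hw ⊢
  exact ⟨hw.1.symm.2, hw.2.symm.2⟩

/-- Over all `v`, the number `d v` of solutions in `A` has mean `#A / q` and small variance. A
sparse `A` would make `d` fall far below this mean throughout `A`, contradicting Cauchy–Schwarz when
`q < t ^ 2`. -/
lemma polarityGraph_locallyDense [DecidableRel (polarityGraph F).Adj] {k t : ℕ}
    (ht : Fintype.card F < t ^ 2) :
    (polarityGraph F).LocallyDense (Fintype.card F * (2 * k + 1 + t)) k := by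
  intro A hA
  by_contra! hle
  set d : F × F → ℕ := fun v ↦ #{w ∈ A | v.2 + w.2 = v.1 * w.1} with hd
  have hq : 0 < Fintype.card F := Fintype.card_pos
  -- The extra 1 pays for `v` itself, which `d v` counts when `v` lies on its own line.
  have hdeg : ∑ v ∈ A, d v ≤ (2 * k + 1) * #A := by
    calc ∑ v ∈ A, d v ≤ ∑ v ∈ A, (#{w ∈ A | (polarityGraph F).Adj v w} + 1) := by
          refine sum_le_sum fun v _ ↦ ?_
          refine le_trans (card_le_card fun w hw ↦ ?_)
            (card_insert_le v {w ∈ A | (polarityGraph F).Adj v w})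
          rw [mem_filter] at hw
          rw [mem_insert, mem_filter]
          by_cases h : w = v
          · exact .inl h
          · exact .inr ⟨hw.1, Ne.symm h, hw.2⟩
      _ ≤ _ := by
        rw [sum_add_distrib]
        simp only [sum_const, smul_eq_mul, mul_one]
        linarith
  have h1 := sum_card_filter_polarity A
  have h2 := sum_card_filter_polarity_sq_le A
  change ∑ v, d v = _ at h1
  change ∑ v, d v ^ 2 ≤ _ at h2
  generalize hqq : Fintype.card F = q at *
  generalize haa : #A = a at *
  zify at h1 h2 hdeg hA ht hq
  have hvar : ∑ v, ((a : ℤ) - q * d v) ^ 2 ≤ q ^ 3 * a := by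
    have : ∑ v, ((a : ℤ) - q * d v) ^ 2 =
        q ^ 2 * a ^ 2 - 2 * q * a * ∑ v, (d v : ℤ) + q ^ 2 * ∑ v, (d v : ℤ) ^ 2 := by
      simp_rw [mul_sum, sub_sq, sum_add_distrib, sum_sub_distrib]
      congr 1
      · congr 1
        · simp only [sum_const, card_univ, Fintype.card_prod, hqq, nsmul_eq_mul]
          push_cast
          ring
        · exact sum_congr rfl fun v _ ↦ by ring
      · exact sum_congr rfl fun v _ ↦ by ring
    rw [this, h1]
    nlinarith [mul_le_mul_of_nonneg_left h2 (sq_nonneg (q : ℤ))]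
  have hcs : (∑ v ∈ A, ((a : ℤ) - q * d v)) ^ 2 ≤ a * (q ^ 3 * a) := by
    refine sq_sum_le_card_mul_sum_sq.trans ?_
    rw [haa]
    gcongr
    exact (sum_le_sum_of_subset_of_nonneg (subset_univ A) fun _ _ _ ↦ sq_nonneg _).trans hvar
  have hlow : (q : ℤ) * t * a ≤ ∑ v ∈ A, ((a : ℤ) - q * d v) := by
    rw [sum_sub_distrib, ← mul_sum]
    simp only [sum_const, haa, nsmul_eq_mul]
    nlinarith [mul_le_mul_of_nonneg_left hdeg hq.le,
      mul_le_mul_of_nonneg_right hA (Int.natCast_nonneg a)]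
  have hsq := (pow_le_pow_left₀ (by positivity) hlow 2).trans hcs
  have ha : (0 : ℤ) < a := lt_of_lt_of_le (by positivity) hA
  have : (q : ℤ) ^ 2 * a ^ 2 * q < q ^ 2 * a ^ 2 * t ^ 2 := by gcongr
  nlinarith

end Polarity

/-- The oriented Ramsey number of the trees on `n` vertices is at most `324 * n ^ 4`. -/
lemma orientedRamsey_orientedTrees_le {n : ℕ} (hn : n ≠ 0) :
    orientedRamsey (orientedTrees n) ≤ (324 * n ^ 4 : ℕ) := by
  classical
  obtain ⟨q, hq, hlt, hle⟩ := Nat.exists_prime_lt_and_le_two_mul (9 * n ^ 2) (by positivity)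
  have : Fact q.Prime := ⟨hq⟩
  have hcard : Fintype.card (ZMod q) = q := ZMod.card q
  refine le_trans (b := ((q ^ 2 : ℕ) : ℕ∞)) (sInf_le ⟨ZMod q × ZMod q, polarityGraph (ZMod q), ?_, ?_⟩) ?_
  · simp [ENat.card_eq_coe_fintype_card, sq]
  · rintro ⟨W, H⟩ ⟨hW, hH, hT⟩ D hD
    obtain ⟨m, rfl⟩ := Nat.exists_eq_succ_of_ne_zero hn
    -- With `n = m + 1`, `t ^ 2 = 25 * n ^ 2` exceeds `q ≤ 18 * n ^ 2`, and `m * (9 * n + 1) < 9 * n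
    -- ^ 2 < q` gives `m * a < q ^ 2`.
    have hdense := polarityGraph_locallyDense (F := ZMod q) (k := 2 * (m + 1)) (t := 5 * (m + 1))
      (by rw [hcard]; simp only [Nat.succ_eq_add_one] at *; nlinarith)
    have hW' : Nat.card W = m + 1 := by
      rw [Nat.card, ← ENat.toNat_natCast (m + 1), ← Nat.succ_eq_add_one, ← hW]
      rfl
    obtain ⟨f, hf, -, hadj⟩ := Digraph.exists_induced_tree hdense polarityGraph_codegree_le_one hD m
      hW' le_rfl hH hT Finset.univ (by
        rw [Finset.card_univ, Fintype.card_prod, hcard]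
        rw [mul_left_comm]
        refine Nat.mul_lt_mul_of_pos_left (lt_trans ?_ hlt) hq.pos
        simp only [Nat.succ_eq_add_one]
        nlinarith)
    exact ⟨f, hf, hadj⟩
  · norm_cast
    calc q ^ 2 ≤ (2 * (9 * n ^ 2)) ^ 2 := by gcongr
      _ = 324 * n ^ 4 := by ring

/-! ### The constant $K$ -/

section Minimum

open Real Set

lemma log_near_of_near_four {x : ℝ} (hx : |1 - x / 4| < 1) (hx0 : x ≠ 0) :
    |∑ i ∈ Finset.range 14, (1 - x / 4) ^ (i + 1) / (i + 1) + log x - 2 * log 2| ≤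
      |1 - x / 4| ^ 15 / (1 - |1 - x / 4|) := by
  have h := abs_log_sub_add_sum_range_le hx 14
  rwa [sub_sub_cancel, log_div hx0 four_ne_zero, show (4 : ℝ) = 2 ^ 2 by norm_num, log_pow,
    ← add_sub_assoc, Nat.cast_ofNat, show (2 : ℝ) ^ 2 = 4 by norm_num] at h

/-- The critical point of `x ↦ x ^ 2 / (1 - x + x * log x)` on `(1, ∞)`. -/
lemma exists_critical_point :
    ∃ x : ℝ, 4.921553 ≤ x ∧ x ≤ 4.921556 ∧ x * log x = 2 * (x - 1) := by
  have hcont : ContinuousOn (fun x : ℝ ↦ x * log x - 2 * (x - 1)) (Icc 4.921553 4.921556) := by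
    refine ContinuousOn.sub (continuous_mul_log.continuousOn) (by fun_prop)
  have h1 : log 4.921553 ≤ 2 * (4.921553 - 1) / 4.921553 := by
    have := (abs_le.mp (log_near_of_near_four (x := 4.921553)
      (by rw [abs_lt]; norm_num) (by norm_num))).2
    rw [abs_of_nonpos (by norm_num)] at this
    norm_num [Finset.sum_range_succ] at this ⊢
    linarith [log_two_lt_d9]
  have h2 : 2 * (4.921556 - 1) / 4.921556 ≤ log 4.921556 := by
    have := (abs_le.mp (log_near_of_near_four (x := 4.921556)
      (by rw [abs_lt]; norm_num) (by norm_num))).1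
    rw [abs_of_nonpos (by norm_num)] at this
    norm_num [Finset.sum_range_succ] at this ⊢
    linarith [log_two_gt_d9]
  obtain ⟨x, hx, h⟩ := intermediate_value_Icc (by norm_num) hcont
    (show (0 : ℝ) ∈ _ from ⟨by linarith, by linarith⟩)
  exact ⟨x, hx.1, hx.2, by simpa [sub_eq_zero] using h⟩

lemma one_sub_add_mul_log_pos {x : ℝ} (hx : 1 < x) : 0 < 1 - x + x * log x := by
  have h := log_lt_sub_one_of_pos (inv_pos.mpr (zero_lt_one.trans hx)) (inv_lt_one_of_one_lt₀ hx).ne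
  rw [log_inv] at h
  have h2 := mul_lt_mul_of_pos_left h (zero_lt_one.trans hx)
  rw [mul_sub, mul_inv_cancel₀ (by linarith)] at h2
  linarith

/-- This is minimality at `a`, divided by `x`. The difference `F` of the two sides vanishes at `a`,
and its derivative changes sign only at `a` and at `a / (a - 1) ≤ 3 / 2`. -/
lemma log_le_of_critical_point {a : ℝ} (ha : 3 ≤ a) (ha5 : a ≤ 5) (hlog : a * log a = 2 * (a - 1)) {x : ℝ}
    (hx : 1 < x) : log x ≤ (a - 1) / a ^ 2 * x + 1 - x⁻¹ := by
  have ha0 : 0 < a := by linarith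
  set F : ℝ → ℝ := fun y ↦ (a - 1) / a ^ 2 * y + 1 - y⁻¹ - log y with hF
  have hFa : F a = 0 := by
    have : log a = 2 * (a - 1) / a := by rw [← hlog]; field_simp
    simp only [hF, this]
    field_simp
    ring
  have hder : ∀ y : ℝ, 0 < y →
      HasDerivAt F ((y - a) * ((a - 1) * y - a) / (a ^ 2 * y ^ 2)) y := by
    intro y hy
    have := ((((hasDerivAt_id y).const_mul ((a - 1) / a ^ 2)).add_const 1).sub
      (hasDerivAt_inv hy.ne')).sub (hasDerivAt_log hy.ne')
    refine this.congr_deriv ?_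
    field_simp
    ring
  suffices 0 ≤ F x by simp only [hF] at this; linarith
  -- Below `3 / 2`, where `F` need not be monotone, `log x ≤ x - 1` is enough; `4 / 25` is the value
  -- of `(a - 1) / a ^ 2` at `a = 5`.
  rcases le_total x 1.5 with h | h
  · have hlogx := log_le_sub_one_of_pos (zero_lt_one.trans hx)
    have hc : (4 : ℝ) / 25 ≤ (a - 1) / a ^ 2 := by
      rw [div_le_div_iff₀ (by norm_num) (by positivity)]
      nlinarith
    have hinv : x⁻¹ * x = 1 := inv_mul_cancel₀ (by linarith)
    have hcx := mul_le_mul_of_nonneg_right hc (by linarith : 0 ≤ x)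
    suffices 0 ≤ 4 / 25 * x + 1 - x⁻¹ - (x - 1) by simp only [hF]; linarith
    refine nonneg_of_mul_nonneg_left ?_ (zero_lt_one.trans hx)
    nlinarith
  rcases le_total x a with hxa | hxa
  · rw [← hFa]
    refine antitoneOn_of_deriv_nonpos (convex_Icc 1.5 a)
      (fun y hy ↦ (hder y (by linarith [hy.1])).continuousAt.continuousWithinAt)
      (fun y hy ↦ ?_) (fun y hy ↦ ?_) ⟨h, hxa⟩ ⟨by linarith, le_rfl⟩ hxa
    · rw [interior_Icc] at hy
      exact (hder y (by linarith [hy.1])).differentiableAt.differentiableWithinAt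
    · rw [interior_Icc] at hy
      rw [(hder y (by linarith [hy.1])).deriv]
      exact div_nonpos_of_nonpos_of_nonneg (mul_nonpos_of_nonpos_of_nonneg (by linarith [hy.2])
        (by nlinarith [hy.1])) (by positivity)
  · rw [← hFa]
    refine monotoneOn_of_deriv_nonneg (convex_Ici a)
      (fun y hy ↦ (hder y (by linarith [mem_Ici.mp hy])).continuousAt.continuousWithinAt)
      (fun y hy ↦ ?_) (fun y hy ↦ ?_) self_mem_Ici hxa hxa
    · rw [interior_Ici] at hy
      exact (hder y (by linarith [mem_Ioi.mp hy])).differentiableAt.differentiableWithinAt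
    · rw [interior_Ici] at hy
      have hy := mem_Ioi.mp hy
      rw [(hder y (by linarith)).deriv]
      exact div_nonneg (mul_nonneg (by linarith) (by nlinarith)) (by positivity)

lemma isLeast_of_critical_point {a : ℝ} (ha : 3 ≤ a) (ha5 : a ≤ 5) (hlog : a * log a = 2 * (a - 1)) :
    IsLeast ((fun x : ℝ ↦ 16 * x ^ 2 / (1 - x + x * log x)) '' Ioi 1) (16 * a ^ 2 / (a - 1)) := by
  refine ⟨⟨a, mem_Ioi.mpr (by linarith), ?_⟩, ?_⟩
  · simp only [hlog]
    congr 1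
    ring
  · rintro _ ⟨x, hx, rfl⟩
    have hx : 1 < x := hx
    have h := mul_le_mul_of_nonneg_left (log_le_of_critical_point ha ha5 hlog hx) (by linarith : 0 ≤ x)
    have h' : x * ((a - 1) / a ^ 2 * x + 1 - x⁻¹) = (a - 1) / a ^ 2 * x ^ 2 + x - 1 := by
      field_simp
    rw [h'] at h
    simp only
    rw [div_le_div_iff₀ (by linarith) (one_sub_add_mul_log_pos hx)]
    calc 16 * a ^ 2 * (1 - x + x * log x) ≤ 16 * a ^ 2 * ((a - 1) / a ^ 2 * x ^ 2) := by
          gcongr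
          linarith
      _ = 16 * x ^ 2 * (a - 1) := by
          have : a ≠ 0 := by linarith
          field_simp

end Minimum

theorem theorem4p6 :
    ∃ K : ℝ,
      IsLeast ((fun x : ℝ => 16 * x ^ 2 / (1 - x + x * Real.log x)) '' Set.Ioi 1) K ∧
      |K - 98.8249| < 0.00005 ∧
      (∀ ε : ℝ, 0 < ε → ∃ n₀ : ℕ, ∀ n : ℕ, n₀ ≤ n →
        ∃ r : ℕ, orientedRamsey (orientedTrees n) = (r : ℕ∞) ∧
          (r : ℝ) < (K + ε) * (n : ℝ) ^ 4 * Real.log n) ∧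
      (∃ n₀ : ℕ, ∀ n : ℕ, n₀ ≤ n →
        ∃ r : ℕ, orientedRamsey (orientedTrees n) = (r : ℕ∞) ∧
          (r : ℝ) < 99 * (n : ℝ) ^ 4 * Real.log n) := by
  obtain ⟨a, ha1, ha2, hlog⟩ := exists_critical_point
  have hK : |16 * a ^ 2 / (a - 1) - 98.8249| < 0.00005 := by
    have : 0 < a - 1 := by linarith
    rw [abs_lt, lt_sub_iff_add_lt, sub_lt_iff_lt_add, lt_div_iff₀ this, div_lt_iff₀ this]
    constructor <;> nlinarith
  have hK98 := (abs_lt.mp hK).1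
  have hbound : ∀ c : ℝ, 98 < c → ∃ n₀ : ℕ, ∀ n : ℕ, n₀ ≤ n →
      ∃ r : ℕ, orientedRamsey (orientedTrees n) = (r : ℕ∞) ∧
        (r : ℝ) < c * (n : ℝ) ^ 4 * Real.log n := by
    -- From here on `log n ≥ 4`, and `324 < 98 * 4`.
    refine fun c hc ↦ ⟨⌈Real.exp 4⌉₊, fun n hn ↦ ?_⟩
    have hexp : Real.exp 4 ≤ n := (Nat.le_ceil _).trans (by exact_mod_cast hn)
    have hn0 : (0 : ℝ) < n := (Real.exp_pos 4).trans_le hexp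
    have hlogn : 4 ≤ Real.log n := (Real.le_log_iff_exp_le hn0).mpr hexp
    have hle := orientedRamsey_orientedTrees_le (n := n) (by rintro rfl; simp at hn0)
    obtain ⟨r, hr⟩ := ENat.ne_top_iff_exists.mp (ne_top_of_le_ne_top (ENat.natCast_ne_top _) hle)
    refine ⟨r, hr.symm, ?_⟩
    rw [← hr, Nat.cast_le] at hle
    calc (r : ℝ) ≤ 324 * (n : ℝ) ^ 4 := by exact_mod_cast hle
      _ < 98 * (n : ℝ) ^ 4 * 4 := by linarith [pow_pos hn0 4]
      _ ≤ c * (n : ℝ) ^ 4 * Real.log n := by gcongr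
  exact ⟨_, isLeast_of_critical_point (by linarith) (by linarith) hlog, hK,
    fun ε hε ↦ hbound _ (by linarith), hbound 99 (by norm_num)⟩
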